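/- Let $\mathcal P$ be a set. In a groupoid with base $\mathcal P$ we write composition in diagrammatic order ($fg$ is defined when the end of $f$ is the source of $g$). A matched pair of groupoids $(\mathcal V,\mathcal H)$ consists of groupoids $\mathcal V$ (source $t$, end $b$) and $\mathcal H$ (source $l$, end $r$) with the same base $\mathcal P$, a left action $\triangleright$ of $\mathcal H$ on $t:\mathcal V\to\mathcal P$ and a right action $\triangleleft$ of $\mathcal V$ on $r:\mathcal H\to\mathcal P$, both defined on pairs $(x,g)$ with $r(x)=t(g)$, such that $b(x\triangleright g)=l(x\triangleleft g)$, $x\triangleright fg=(x\triangleright f)((x\triangleleft f)\triangleright g)$ and $xy\triangleleft g=(x\triangleleft(y\triangleright g))(y\triangleleft g)$. A representation of $(\mathcal V,\mathcal H)$ is a set $\mathcal E$ with maps $p,q:\mathcal E\to\mathcal P$, a left action $\triangleright$ of $\mathcal H$ on $p$ and a degree map $|\cdot|:\mathcal E\to\mathcal V$ such that $p(e)=t(|e|)$, $q(e)=b(|e|)$ and $|x\triangleright e|=x\triangleright|e|$. Morphisms are the maps that preserve degrees and intertwine the actions. The category $\operatorname{Rep}(\mathcal V,\mathcal H)$ is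 monoidal, with $\mathcal E\otimes\mathcal F=\{(e,f): q(e)=p(f)\}$, $p(e,f)=p(e)$, $q(e,f)=q(f)$, $x\triangleright(e,f)=(x\triangleright e,(x\triangleleft|e|)\triangleright f)$, $|(e,f)|=|e||f|$, with unit object $\mathcal P$ (where $|P|=\mathrm{id}_{\mathcal V}P$ and $x\triangleright r(x)=l(x)$), and with the evident associativity and unit constraints. The double $D(\mathcal V,\mathcal H)$ is the matched pair whose vertical groupoid consists of the pairs $(\gamma,x)\in\mathcal V\times\mathcal H$ with $t(\gamma)=r(x)$, $b(\gamma)=l(x)$, with source $t(\gamma)$, end $b(\gamma)$ and product $(\gamma,x)(\gamma',x')=(\gamma\gamma',x'x)$; whose horizontal groupoid $\mathcal V\bowtie\mathcal H$ consists of the pairs $(g,h)$ with $b(g)=l(h)$, with source $t(g)$, end $r(h)$ and product $(f,y)(h,z)=(f(y\triangleright h),(y\triangleleft h)z)$; and whose actions are, for $r(h)=t(\gamma)$ and $\Omega=(h\triangleleft\gamma)xh^{-1}$, $$(g,h)\rightharpoonup(\gamma,x)=\bigl(g(h\triangleright\gamma)(\Omega\triangleright g^{-1}),\ \Omega\triangleleft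 g^{-1}\bigr),\qquad (g,h)\leftharpoonup(\gamma,x)=\bigl((\Omega\triangleleft g^{-1})\triangleright g,\ h\triangleleft\gamma\bigr).$$ For an element $d$ of a representation of $D(\mathcal V,\mathcal H)$ write $|d|=(|d|_{\mathcal V},|d|_{\mathcal H})$ for its degree, and let $g\in\mathcal V$ and $x\in\mathcal H$ act on it through $(g,\mathrm{id}_{\mathcal H}\,b(g))$ and $(\mathrm{id}_{\mathcal V}\,l(x),x)$ in $\mathcal V\bowtie\mathcal H$. **Corollary.** For every matched pair of groupoids $(\mathcal V,\mathcal H)$, the monoidal category $\operatorname{Rep}D(\mathcal V,\mathcal H)$ is braided: there is a braiding on it which, for all representations $E$ and $D$ of $D(\mathcal V,\mathcal H)$, is the map $c_{E,D}:E\otimes D\to D\otimes E$ given by $$c_{E,D}(e,d)=\bigl(|e|_{\mathcal V}\triangleright d,\ (|d|_{\mathcal H}\triangleleft|e|_{\mathcal V}^{-1})\triangleright e\bigr).$$ -/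

import Mathlib

open CategoryTheory

universe u

/-- A groupoid with base (set of objects) `P`, given by its set of arrows, its source and end
maps, identities, inverses and its partially defined composition. The composition is written in
diagrammatic order: `comp f g` is "first `f`, then `g`" and is defined when `tgt f = src g`. -/
structure GroupoidOver (P : Type u) where
  Arr : Type u
  src : Arr → P
  tgt : Arr → P
  id : P → Arr
  inv : Arr → Arr
  comp : (f g : Arr) → tgt f = src g → Arr
  src_id : ∀ X, src (id X) = X
  tgt_id : ∀ X, tgt (id X) = X
  src_inv : ∀ f, src (inv f) = tgt f
  tgt_inv : ∀ f, tgt (inv f) = src f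
  src_comp : ∀ f g h, src (comp f g h) = src f
  tgt_comp : ∀ f g h, tgt (comp f g h) = tgt g
  assoc : ∀ f g k (h₁ : tgt f = src g) (h₂ : tgt g = src k),
    comp (comp f g h₁) k ((tgt_comp f g h₁).trans h₂) =
      comp f (comp g k h₂) (h₁.trans (src_comp g k h₂).symm)
  id_comp : ∀ f, comp (id (src f)) f (tgt_id _) = f
  comp_id : ∀ f, comp f (id (tgt f)) (src_id _).symm = f
  comp_inv : ∀ f, comp f (inv f) (src_inv f).symm = id (src f)
  inv_comp : ∀ f, comp (inv f) f (tgt_inv f) = id (tgt f)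

namespace GroupoidOver

attribute [simp] src_id tgt_id src_inv tgt_inv src_comp tgt_comp

variable {P : Type u} (G : GroupoidOver P)

theorem id_comp' {X : P} {f : G.Arr} (h : G.tgt (G.id X) = G.src f) :
    G.comp (G.id X) f h = f := by
  obtain rfl : X = G.src f := by simpa using h
  exact G.id_comp f

theorem comp_id' {X : P} {f : G.Arr} (h : G.tgt f = G.src (G.id X)) :
    G.comp f (G.id X) h = f := by
  obtain rfl : G.tgt f = X := by simpa using h
  exact G.comp_id f

theorem inv_comp_cancel {f g : G.Arr} (h : G.tgt f = G.src g) :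
    G.comp (G.inv f) (G.comp f g h) (by simp) = g := by
  rw [← G.assoc _ _ _ (by simp) h]
  simp only [G.inv_comp]
  exact G.id_comp' _

theorem comp_inv_cancel {f g : G.Arr} (h : G.tgt f = G.src g) :
    G.comp (G.comp f g h) (G.inv g) (by simp) = f := by
  rw [G.assoc _ _ _ h (by simp)]
  simp only [G.comp_inv]
  exact G.comp_id' _

theorem comp_congr {f f' g g' : G.Arr} (hf : f = f') (hg : g = g') (h : G.tgt f = G.src g)
    (h' : G.tgt f' = G.src g') : G.comp f g h = G.comp f' g' h' := by
  subst hf hg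
  rfl

theorem paste {p q r a a' b b' : G.Arr} (h₁ : G.tgt p = G.src a') (h₂ : G.tgt a = G.src q)
    (h₃ : G.tgt q = G.src b') (h₄ : G.tgt b = G.src r) (h : G.tgt a = G.src b)
    (h' : G.tgt a' = G.src b') (e₁ : G.comp p a' h₁ = G.comp a q h₂)
    (e₂ : G.comp q b' h₃ = G.comp b r h₄) :
    G.comp p (G.comp a' b' h') (by simpa using h₁) =
      G.comp (G.comp a b h) r (by simpa using h₄) := by
  rw [← G.assoc _ _ _ h₁ h', G.assoc _ _ _ h h₄]
  refine (G.comp_congr e₁ rfl _ (by simpa using h₃)).trans ?_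
  rw [G.assoc _ _ _ h₂ h₃]
  exact G.comp_congr rfl e₂ _ _

theorem left_cancel {f g g' : G.Arr} (h : G.tgt f = G.src g) (h' : G.tgt f = G.src g')
    (e : G.comp f g h = G.comp f g' h') : g = g' := by
  rw [← G.inv_comp_cancel h, ← G.inv_comp_cancel h']
  simp only [e]

theorem right_cancel {f f' g : G.Arr} (h : G.tgt f = G.src g) (h' : G.tgt f' = G.src g)
    (e : G.comp f g h = G.comp f' g h') : f = f' := by
  rw [← G.comp_inv_cancel h, ← G.comp_inv_cancel h']
  simp only [e]

/-- The opposite groupoid: source and end maps are switched. -/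
def op : GroupoidOver P where
  Arr := G.Arr
  src := G.tgt
  tgt := G.src
  id := G.id
  inv := G.inv
  comp f g h := G.comp g f h.symm
  src_id := G.tgt_id
  tgt_id := G.src_id
  src_inv := G.tgt_inv
  tgt_inv := G.src_inv
  src_comp f g h := G.tgt_comp g f h.symm
  tgt_comp f g h := G.src_comp g f h.symm
  assoc f g k h₁ h₂ := (G.assoc k g f h₂.symm h₁.symm).symm
  id_comp := G.comp_id
  comp_id := G.id_comp
  comp_inv := G.inv_comp
  inv_comp := G.comp_inv

/-- The restricted product of two groupoids with the same base: pairs of parallel arrows, with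
componentwise composition. -/
def restrictedProd (K : GroupoidOver P) : GroupoidOver P where
  Arr := {a : G.Arr × K.Arr // G.src a.1 = K.src a.2 ∧ G.tgt a.1 = K.tgt a.2}
  src a := G.src a.1.1
  tgt a := G.tgt a.1.1
  id X := ⟨(G.id X, K.id X), by simp, by simp⟩
  inv a := ⟨(G.inv a.1.1, K.inv a.1.2), by simp [a.2.2], by simp [a.2.1]⟩
  comp a b h := ⟨(G.comp a.1.1 b.1.1 h,
    K.comp a.1.2 b.1.2 (a.2.2.symm.trans (h.trans b.2.1))), by simp [a.2.1], by simp [b.2.2]⟩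
  src_id := by simp
  tgt_id := by simp
  src_inv := by simp
  tgt_inv := by simp
  src_comp := by simp
  tgt_comp := by simp
  assoc a b c h₁ h₂ := Subtype.ext (Prod.ext (G.assoc _ _ _ _ _) (K.assoc _ _ _ _ _))
  id_comp a := Subtype.ext (Prod.ext (G.id_comp' _) (K.id_comp' _))
  comp_id a := Subtype.ext (Prod.ext (G.comp_id' _) (K.comp_id' _))
  comp_inv a := Subtype.ext (Prod.ext (G.comp_inv _) ((K.comp_inv _).trans (by rw [a.2.1])))
  inv_comp a := Subtype.ext (Prod.ext (G.inv_comp _) ((K.inv_comp _).trans (by rw [a.2.2])))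

end GroupoidOver

/-- A matched pair of groupoids `(V, H)` with base `P`: `V` is the vertical groupoid (source
"top", end "bottom"), `H` is the horizontal one (source "left", end "right"). For `x` in `H` and
`g` in `V` with `r(x) = t(g)`, `lact x g` is `x ▷ g` (a left action of `H` on `t : V → P`) and
`ract x g` is `x ◁ g` (a right action of `V` on `r : H → P`). -/
structure MatchedPair (P : Type u) where
  V : GroupoidOver P
  H : GroupoidOver P
  lact : (x : H.Arr) → (g : V.Arr) → H.tgt x = V.src g → V.Arr
  ract : (x : H.Arr) → (g : V.Arr) → H.tgt x = V.src g → H.Arr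
  src_lact : ∀ x g h, V.src (lact x g h) = H.src x
  tgt_ract : ∀ x g h, H.tgt (ract x g h) = V.tgt g
  tgt_lact : ∀ x g h, V.tgt (lact x g h) = H.src (ract x g h)
  lact_lact : ∀ x y g (h₁ : H.tgt x = H.src y) (h₂ : H.tgt y = V.src g),
    lact x (lact y g h₂) (h₁.trans (src_lact y g h₂).symm) =
      lact (H.comp x y h₁) g ((H.tgt_comp x y h₁).trans h₂)
  id_lact : ∀ g, lact (H.id (V.src g)) g (H.tgt_id _) = g
  ract_ract : ∀ x f g (h₁ : H.tgt x = V.src f) (h₂ : V.tgt f = V.src g),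
    ract (ract x f h₁) g ((tgt_ract x f h₁).trans h₂) =
      ract x (V.comp f g h₂) (h₁.trans (V.src_comp f g h₂).symm)
  ract_id : ∀ x, ract x (V.id (H.tgt x)) (V.src_id _).symm = x
  lact_comp : ∀ x f g (h₁ : H.tgt x = V.src f) (h₂ : V.tgt f = V.src g),
    lact x (V.comp f g h₂) (h₁.trans (V.src_comp f g h₂).symm) =
      V.comp (lact x f h₁) (lact (ract x f h₁) g ((tgt_ract x f h₁).trans h₂))
        ((tgt_lact x f h₁).trans (src_lact _ _ _).symm)
  comp_ract : ∀ x y g (h₁ : H.tgt x = H.src y) (h₂ : H.tgt y = V.src g),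
    ract (H.comp x y h₁) g ((H.tgt_comp x y h₁).trans h₂) =
      H.comp (ract x (lact y g h₂) (h₁.trans (src_lact y g h₂).symm)) (ract y g h₂)
        ((tgt_ract _ _ _).trans (tgt_lact y g h₂))

namespace MatchedPair

attribute [simp] src_lact tgt_ract tgt_lact

variable {P : Type u} (M : MatchedPair P)

theorem id_lact' {X : P} {g : M.V.Arr} (h : M.H.tgt (M.H.id X) = M.V.src g) :
    M.lact (M.H.id X) g h = g := by
  obtain rfl : X = M.V.src g := by simpa using h
  exact M.id_lact g

theorem ract_id' {X : P} {x : M.H.Arr} (h : M.H.tgt x = M.V.src (M.V.id X)) :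
    M.ract x (M.V.id X) h = x := by
  obtain rfl : M.H.tgt x = X := by simpa using h
  exact M.ract_id x

theorem lact_id {X : P} {x : M.H.Arr} (h : M.H.tgt x = M.V.src (M.V.id X)) :
    M.lact x (M.V.id X) h = M.V.id (M.H.src x) := by
  have e := M.lact_comp x (M.V.id X) (M.V.id X) h (by simp)
  simp only [M.V.id_comp', M.ract_id'] at e
  refine M.V.left_cancel (f := M.lact x (M.V.id X) h) (by simp [M.ract_id'])
    (by simp [M.ract_id']) (e.symm.trans (M.V.comp_id' _).symm)

theorem id_ract {X : P} {g : M.V.Arr} (h : M.H.tgt (M.H.id X) = M.V.src g) :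
    M.ract (M.H.id X) g h = M.H.id (M.V.tgt g) := by
  have e := M.comp_ract (M.H.id X) (M.H.id X) g (by simp) h
  simp only [M.H.id_comp', M.id_lact'] at e
  have h' : M.V.tgt g = M.H.src (M.ract (M.H.id X) g h) := by
    rw [← M.tgt_lact, M.id_lact']
  exact M.H.right_cancel (g := M.ract (M.H.id X) g h) (by simpa using h') (by simpa using h')
    (e.symm.trans (M.H.id_comp' (by simpa using h')).symm)

/-- The diagonal groupoid `V ⋈ H`: arrows are the corners `(f, y)` with `b(f) = l(y)`, and
`(f, y)(h, z) = (f (y ▷ h), (y ◁ h) z)`. -/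
def diag : GroupoidOver P where
  Arr := {a : M.V.Arr × M.H.Arr // M.V.tgt a.1 = M.H.src a.2}
  src a := M.V.src a.1.1
  tgt a := M.H.tgt a.1.2
  id X := ⟨(M.V.id X, M.H.id X), by simp⟩
  inv a := ⟨(M.lact (M.H.inv a.1.2) (M.V.inv a.1.1) (by simp [a.2]),
    M.ract (M.H.inv a.1.2) (M.V.inv a.1.1) (by simp [a.2])), by simp⟩
  comp a b h :=
    ⟨(M.V.comp a.1.1 (M.lact a.1.2 b.1.1 h) (by simp [a.2]),
      M.H.comp (M.ract a.1.2 b.1.1 h) b.1.2 (by simp [b.2])), by simp⟩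
  src_id := by simp
  tgt_id := by simp
  src_inv := by simp
  tgt_inv := by simp
  src_comp := by simp
  tgt_comp := by simp
  assoc a b c h₁ h₂ := by
    have e₁ := M.lact_comp a.1.2 b.1.1 (M.lact b.1.2 c.1.1 h₂) h₁ (by simp [b.2])
    have e₂ := M.lact_lact (M.ract a.1.2 b.1.1 h₁) b.1.2 c.1.1 (by simp [b.2]) h₂
    have e₃ := M.comp_ract (M.ract a.1.2 b.1.1 h₁) b.1.2 c.1.1 (by simp [b.2]) h₂
    have e₄ := M.ract_ract a.1.2 b.1.1 (M.lact b.1.2 c.1.1 h₂) h₁ (by simp [b.2])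
    refine Subtype.ext (Prod.ext ?_ ?_)
    · simp only [e₁, ← e₂]
      exact M.V.assoc _ _ _ _ _
    · simp only [e₃, ← e₄]
      exact M.H.assoc _ _ _ _ _
  id_comp a := by
    refine Subtype.ext (Prod.ext ?_ ?_)
    · simp only [M.id_lact', M.V.id_comp']
    · simp only [M.id_ract, M.H.id_comp']
  comp_id a := by
    refine Subtype.ext (Prod.ext ?_ ?_)
    · simp only [M.lact_id, M.V.comp_id']
    · simp only [M.ract_id', M.H.comp_id']
  comp_inv a := by
    have e₁ := M.lact_lact a.1.2 (M.H.inv a.1.2) (M.V.inv a.1.1) (by simp) (by simp [a.2])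
    have e₂ := M.comp_ract a.1.2 (M.H.inv a.1.2) (M.V.inv a.1.1) (by simp) (by simp [a.2])
    refine Subtype.ext (Prod.ext ?_ ?_)
    · simp only [e₁, M.H.comp_inv, M.id_lact', M.V.comp_inv]
    · simp only [← e₂, M.H.comp_inv, M.id_ract, M.V.tgt_inv]
  inv_comp a := by
    have e₁ := M.lact_comp (M.H.inv a.1.2) (M.V.inv a.1.1) a.1.1 (by simp [a.2]) (by simp)
    have e₂ := M.ract_ract (M.H.inv a.1.2) (M.V.inv a.1.1) a.1.1 (by simp [a.2]) (by simp)
    refine Subtype.ext (Prod.ext ?_ ?_)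
    · simp only [← e₁, M.V.inv_comp, M.lact_id, M.H.src_inv]
    · simp only [e₂, M.V.inv_comp, M.ract_id', M.H.inv_comp]

/-- The vertical component of a corner. -/
def diagV (a : M.diag.Arr) : M.V.Arr := a.1.1

/-- The horizontal component of a corner. -/
def diagH (a : M.diag.Arr) : M.H.Arr := a.1.2

/-- The corner `(f, y)`, where `b(f) = l(y)`. -/
def corner (f : M.V.Arr) (y : M.H.Arr) (h : M.V.tgt f = M.H.src y) : M.diag.Arr := ⟨(f, y), h⟩

@[simp] theorem diagV_corner (f : M.V.Arr) (y : M.H.Arr) (h) : M.diagV (M.corner f y h) = f := rfl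

@[simp] theorem diagH_corner (f : M.V.Arr) (y : M.H.Arr) (h) : M.diagH (M.corner f y h) = y := rfl

@[simp] theorem src_diagH (a : M.diag.Arr) : M.H.src (M.diagH a) = M.V.tgt (M.diagV a) :=
  a.2.symm

theorem src_diag (a : M.diag.Arr) : M.diag.src a = M.V.src (M.diagV a) := rfl

theorem tgt_diag (a : M.diag.Arr) : M.diag.tgt a = M.H.tgt (M.diagH a) := rfl

theorem diag_ext {a b : M.diag.Arr} (h₁ : M.diagV a = M.diagV b) (h₂ : M.diagH a = M.diagH b) :
    a = b := Subtype.ext (Prod.ext h₁ h₂)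

theorem diagV_id (X : P) : M.diagV (M.diag.id X) = M.V.id X := rfl

theorem diagH_id (X : P) : M.diagH (M.diag.id X) = M.H.id X := rfl

theorem diagV_comp (a b : M.diag.Arr) (h : M.diag.tgt a = M.diag.src b) :
    M.diagV (M.diag.comp a b h) =
    M.V.comp (M.diagV a) (M.lact (M.diagH a) (M.diagV b) (by rwa [← tgt_diag, ← src_diag]))
      (by simp) := rfl

theorem diagH_comp (a b : M.diag.Arr) (h : M.diag.tgt a = M.diag.src b) :
    M.diagH (M.diag.comp a b h) =
    M.H.comp (M.ract (M.diagH a) (M.diagV b) (by rwa [← tgt_diag, ← src_diag])) (M.diagH b)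
      (by simp) := rfl

/-- The inclusion `V → V ⋈ H`, `g ↦ (g, id b(g))`. -/
def inclV (g : M.V.Arr) : M.diag.Arr := M.corner g (M.H.id (M.V.tgt g)) (by simp)

/-- The inclusion `H → V ⋈ H`, `x ↦ (id l(x), x)`. -/
def inclH (x : M.H.Arr) : M.diag.Arr := M.corner (M.V.id (M.H.src x)) x (by simp)

@[simp] theorem diagV_inclV (g : M.V.Arr) : M.diagV (M.inclV g) = g := rfl

@[simp] theorem diagH_inclV (g : M.V.Arr) : M.diagH (M.inclV g) = M.H.id (M.V.tgt g) := rfl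

@[simp] theorem diagV_inclH (x : M.H.Arr) : M.diagV (M.inclH x) = M.V.id (M.H.src x) := rfl

@[simp] theorem diagH_inclH (x : M.H.Arr) : M.diagH (M.inclH x) = x := rfl

@[simp] theorem src_inclV (g : M.V.Arr) : M.diag.src (M.inclV g) = M.V.src g := rfl

@[simp] theorem tgt_inclV (g : M.V.Arr) : M.diag.tgt (M.inclV g) = M.V.tgt g := M.H.tgt_id _

@[simp] theorem src_inclH (x : M.H.Arr) : M.diag.src (M.inclH x) = M.H.src x := M.V.src_id _

@[simp] theorem tgt_inclH (x : M.H.Arr) : M.diag.tgt (M.inclH x) = M.H.tgt x := rfl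

theorem inclV_id (X : P) : M.inclV (M.V.id X) = M.diag.id X :=
  M.diag_ext rfl (congrArg M.H.id (M.V.tgt_id X))

theorem inclH_id (X : P) : M.inclH (M.H.id X) = M.diag.id X :=
  M.diag_ext (congrArg M.V.id (M.H.src_id X)) rfl

theorem inclV_comp {f g : M.V.Arr} (h : M.V.tgt f = M.V.src g) :
    M.inclV (M.V.comp f g h) = M.diag.comp (M.inclV f) (M.inclV g) (by simpa using h) := by
  refine M.diag_ext ?_ ?_
  · simp only [diagV_comp, diagV_inclV, diagH_inclV, M.id_lact']
  · simp only [diagH_comp, diagV_inclV, diagH_inclV, M.id_ract, M.H.id_comp', M.V.tgt_comp]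

theorem inclH_comp {x y : M.H.Arr} (h : M.H.tgt x = M.H.src y) :
    M.inclH (M.H.comp x y h) = M.diag.comp (M.inclH x) (M.inclH y) (by simpa using h) := by
  refine M.diag_ext ?_ ?_
  · simp only [diagV_comp, diagV_inclH, diagH_inclH, M.lact_id, M.V.id_comp', M.H.src_comp]
  · simp only [diagH_comp, diagV_inclH, diagH_inclH, M.ract_id']

theorem inclV_comp_inclH {f : M.V.Arr} {y : M.H.Arr} (h : M.V.tgt f = M.H.src y) :
    M.diag.comp (M.inclV f) (M.inclH y) (by simpa using h) = M.corner f y h := by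
  refine M.diag_ext ?_ ?_
  · simp only [diagV_comp, diagV_inclH, diagH_inclV, diagV_inclV, diagV_corner, M.lact_id,
      M.V.comp_id', M.H.src_id]
  · simp only [diagH_comp, diagV_inclH, diagH_inclH, diagH_inclV, diagH_corner, M.ract_id',
      M.H.id_comp']

theorem inclH_comp_inclV {x : M.H.Arr} {g : M.V.Arr} (h : M.H.tgt x = M.V.src g) :
    M.diag.comp (M.inclH x) (M.inclV g) (by simpa using h) =
      M.diag.comp (M.inclV (M.lact x g h)) (M.inclH (M.ract x g h)) (by simp) := by
  rw [M.inclV_comp_inclH (by simp)]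
  refine M.diag_ext ?_ ?_
  · simp only [diagV_comp, diagV_inclH, diagH_inclH, diagV_inclV, diagV_corner, M.V.id_comp']
  · simp only [diagH_comp, diagH_inclH, diagH_inclV, diagV_inclV, diagH_corner, M.H.comp_id']

theorem diag_eq (a : M.diag.Arr) :
    a = M.diag.comp (M.inclV (M.diagV a)) (M.inclH (M.diagH a)) (by simp) :=
  (M.inclV_comp_inclH (M.src_diagH a).symm).symm

/-- The vertical groupoid `V ⊡ H^op` of the double: the restricted product of `V` and the opposite
of `H`. -/
abbrev doubleV : GroupoidOver P := M.V.restrictedProd M.H.op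

/-- The component in `V` of an arrow of `V ⊡ H^op`. -/
def vPart (c : M.doubleV.Arr) : M.V.Arr := c.1.1

/-- The component in `H` of an arrow of `V ⊡ H^op`. -/
def hPart (c : M.doubleV.Arr) : M.H.Arr := c.1.2

/-- The arrow `(γ, x)` of `V ⊡ H^op`, where `r(x) = t(γ)` and `b(γ) = l(x)`. -/
def mkDoubleV (γ : M.V.Arr) (x : M.H.Arr) (h₁ : M.H.tgt x = M.V.src γ)
    (h₂ : M.V.tgt γ = M.H.src x) : M.doubleV.Arr := ⟨(γ, x), h₁.symm, h₂⟩

@[simp] theorem tgt_hPart (c : M.doubleV.Arr) : M.H.tgt (M.hPart c) = M.V.src (M.vPart c) :=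
  c.2.1.symm

@[simp] theorem src_hPart (c : M.doubleV.Arr) : M.H.src (M.hPart c) = M.V.tgt (M.vPart c) :=
  c.2.2.symm

@[simp] theorem src_doubleV (c : M.doubleV.Arr) : M.doubleV.src c = M.V.src (M.vPart c) := rfl

@[simp] theorem tgt_doubleV (c : M.doubleV.Arr) : M.doubleV.tgt c = M.V.tgt (M.vPart c) := rfl

@[simp] theorem vPart_mk (γ : M.V.Arr) (x : M.H.Arr) (h₁ h₂) :
    M.vPart (M.mkDoubleV γ x h₁ h₂) = γ := rfl

@[simp] theorem hPart_mk (γ : M.V.Arr) (x : M.H.Arr) (h₁ h₂) :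
    M.hPart (M.mkDoubleV γ x h₁ h₂) = x := rfl

/-- The horizontal arrow `Ω = (h ◁ γ) x h⁻¹` attached to `(g, h)` and `(γ, x)`. -/
def doubleOmega (a : M.diag.Arr) (c : M.doubleV.Arr) (hac : M.H.tgt (M.diagH a) = M.V.src (M.vPart c)) :
    M.H.Arr :=
  M.H.comp
    (M.H.comp (M.ract (M.diagH a) (M.vPart c) hac) (M.hPart c) (by simp))
    (M.H.inv (M.diagH a)) (by simp [hac])

@[simp] theorem src_doubleOmega (a : M.diag.Arr) (c : M.doubleV.Arr)
    (hac : M.H.tgt (M.diagH a) = M.V.src (M.vPart c)) :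
    M.H.src (M.doubleOmega a c hac) = M.H.src (M.ract (M.diagH a) (M.vPart c) hac) := by
  simp [doubleOmega]

@[simp] theorem tgt_doubleOmega (a : M.diag.Arr) (c : M.doubleV.Arr)
    (hac : M.H.tgt (M.diagH a) = M.V.src (M.vPart c)) :
    M.H.tgt (M.doubleOmega a c hac) = M.V.tgt (M.diagV a) := by
  simp [doubleOmega]

/-- `(g, h) ⇀ (γ, x) = (g (h ▷ γ) (Ω ▷ g⁻¹), Ω ◁ g⁻¹)`. -/
def doubleLact (a : M.diag.Arr) (c : M.doubleV.Arr) (hac : M.H.tgt (M.diagH a) = M.V.src (M.vPart c)) :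
    M.doubleV.Arr :=
  M.mkDoubleV (M.V.comp (M.V.comp (M.diagV a) (M.lact (M.diagH a) (M.vPart c) hac) (by simp))
      (M.lact (M.doubleOmega a c hac) (M.V.inv (M.diagV a)) (by simp)) (by simp))
    (M.ract (M.doubleOmega a c hac) (M.V.inv (M.diagV a)) (by simp)) (by simp) (by simp)

/-- `(g, h) ↼ (γ, x) = ((Ω ◁ g⁻¹) ▷ g, h ◁ γ)`. -/
def doubleRact (a : M.diag.Arr) (c : M.doubleV.Arr) (hac : M.H.tgt (M.diagH a) = M.V.src (M.vPart c)) :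
    M.diag.Arr :=
  M.corner (M.lact (M.ract (M.doubleOmega a c hac) (M.V.inv (M.diagV a)) (by simp)) (M.diagV a)
    (by simp)) (M.ract (M.diagH a) (M.vPart c) hac) (by
      have e := M.ract_ract (M.doubleOmega a c hac) (M.V.inv (M.diagV a)) (M.diagV a) (by simp) (by simp)
      simp only [M.V.inv_comp, M.ract_id'] at e
      simp [e])

theorem src_doubleLact (a : M.diag.Arr) (c : M.doubleV.Arr)
    (hac : M.H.tgt (M.diagH a) = M.V.src (M.vPart c)) :
    M.doubleV.src (M.doubleLact a c hac) = M.diag.src a := by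
  simp [doubleLact, src_diag]

theorem tgt_doubleRact (a : M.diag.Arr) (c : M.doubleV.Arr)
    (hac : M.H.tgt (M.diagH a) = M.V.src (M.vPart c)) :
    M.diag.tgt (M.doubleRact a c hac) = M.doubleV.tgt c := by
  simp [doubleRact, tgt_diag]

theorem tgt_doubleLact (a : M.diag.Arr) (c : M.doubleV.Arr)
    (hac : M.H.tgt (M.diagH a) = M.V.src (M.vPart c)) :
    M.doubleV.tgt (M.doubleLact a c hac) = M.diag.src (M.doubleRact a c hac) := by
  simp [doubleLact, doubleRact, src_diag]

/-- The two commuting squares in the diagonal groupoid which characterize the actions of the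
double. -/
structure DoubleCell (a a' : M.diag.Arr) (c c' : M.doubleV.Arr) : Prop where
  right : M.diag.tgt a = M.V.src (M.vPart c)
  left : M.diag.src a = M.V.src (M.vPart c')
  right' : M.diag.tgt a' = M.V.tgt (M.vPart c)
  left' : M.diag.src a' = M.V.tgt (M.vPart c')
  sqV : M.diag.comp (M.inclV (M.vPart c')) a' (by simp [left']) =
    M.diag.comp a (M.inclV (M.vPart c)) (by simp [right])
  sqH : M.diag.comp (M.inclH (M.hPart c')) a (by simp [left]) =
    M.diag.comp a' (M.inclH (M.hPart c)) (by simp [right'])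

variable {M}

theorem DoubleCell.unique {a a₁ a₂ : M.diag.Arr} {c c₁ c₂ : M.doubleV.Arr}
    (h₁ : M.DoubleCell a a₁ c c₁) (h₂ : M.DoubleCell a a₂ c c₂) : c₁ = c₂ ∧ a₁ = a₂ := by
  have key : ∀ {a' : M.diag.Arr} {c' : M.doubleV.Arr} (h : M.DoubleCell a a' c c'),
      M.diag.comp (M.diag.comp (M.inclV (M.vPart c')) (M.inclH (M.hPart c')) (by simp))
        a (by simp [h.left]) =
      M.diag.comp a (M.diag.comp (M.inclV (M.vPart c)) (M.inclH (M.hPart c)) (by simp))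
        (by simp [h.right]) := by
    intro a' c' h
    rw [M.diag.assoc _ _ _ _ (by simp [h.left])]
    simp only [h.sqH]
    rw [← M.diag.assoc _ _ _ (by simp [h.left']) (by simp [h.right'])]
    simp only [h.sqV]
    exact M.diag.assoc _ _ _ _ _
  have e := M.diag.right_cancel _ _ ((key h₁).trans (key h₂).symm)
  rw [M.inclV_comp_inclH (by simp), M.inclV_comp_inclH (by simp)] at e
  have hc : c₁ = c₂ := Subtype.ext (congrArg (fun z : M.diag.Arr => z.1) e)
  subst hc
  exact ⟨rfl, M.diag.left_cancel _ _ (h₁.sqV.trans h₂.sqV.symm)⟩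

theorem doubleCell (a : M.diag.Arr) (c : M.doubleV.Arr)
    (hac : M.H.tgt (M.diagH a) = M.V.src (M.vPart c)) :
    M.DoubleCell a (M.doubleRact a c hac) c (M.doubleLact a c hac) where
  right := hac
  left := (M.src_doubleLact a c hac).symm
  right' := M.tgt_doubleRact a c hac
  left' := (M.tgt_doubleLact a c hac).symm
  sqV := by
    have hk : M.V.tgt (M.diagV a) = M.V.src (M.lact (M.diagH a) (M.vPart c) hac) := by simp
    have hr : M.diag.comp (M.inclV (M.lact (M.diagH a) (M.vPart c) hac)) (M.inclH (M.ract (M.diagH a) (M.vPart c) hac))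
        (by simp) = M.diag.comp (M.inclH (M.diagH a)) (M.inclV (M.vPart c)) (by simpa using hac) :=
      (M.inclH_comp_inclV hac).symm
    have hV : M.V.comp (M.vPart (M.doubleLact a c hac)) (M.diagV (M.doubleRact a c hac))
        (by simp [doubleLact, doubleRact]) = M.V.comp (M.diagV a) (M.lact (M.diagH a) (M.vPart c) hac) hk := by
      have e := M.lact_comp (M.doubleOmega a c hac) (M.V.inv (M.diagV a)) (M.diagV a)
        (by simp) (by simp)
      simp only [M.V.inv_comp, M.lact_id] at e
      refine (M.V.assoc _ _ _ _ (by simp [doubleRact])).trans ?_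
      exact (M.V.comp_congr rfl e.symm _ (by simp)).trans (M.V.comp_id' _)
    calc _ = M.diag.comp (M.inclV (M.vPart (M.doubleLact a c hac)))
          (M.diag.comp (M.inclV (M.diagV (M.doubleRact a c hac))) (M.inclH (M.diagH (M.doubleRact a c hac)))
            (by simp))
          (by simp [doubleLact, doubleRact]) := by
            congr 1
            exact M.diag_eq _
      _ = M.diag.comp (M.inclV (M.V.comp (M.diagV a) (M.lact (M.diagH a) (M.vPart c) hac) hk))
          (M.inclH (M.ract (M.diagH a) (M.vPart c) hac)) (by simp) := by
            rw [← M.diag.assoc _ _ _ (by simp [doubleLact, doubleRact])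
              (by simp)]
            refine M.diag.comp_congr ?_ rfl _ _
            rw [← M.inclV_comp (by simp [doubleLact, doubleRact])]
            exact congrArg M.inclV hV
      _ = M.diag.comp (M.inclV (M.diagV a)) (M.diag.comp (M.inclH (M.diagH a)) (M.inclV (M.vPart c))
          (by simpa using hac)) (by simp) := by
            simp only [M.inclV_comp hk]
            rw [M.diag.assoc _ _ _ _ (by simp)]
            simp only [hr]
      _ = _ := by
            rw [← M.diag.assoc _ _ _ (by simp)]
            simp only [← M.diag_eq a]
  sqH := by
    have hx : M.H.comp (M.doubleOmega a c hac) (M.diagH a) (by simp) =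
        M.H.comp (M.ract (M.diagH a) (M.vPart c) hac) (M.hPart c)
          (by simp) := by
      simp only [doubleOmega]
      rw [M.H.assoc _ _ _ _ (by simp)]
      simp only [M.H.inv_comp]
      exact M.H.comp_id' _
    have hO : M.ract (M.ract (M.doubleOmega a c hac) (M.V.inv (M.diagV a)) (by simp)) (M.diagV a) (by simp) =
        M.doubleOmega a c hac := by
      rw [M.ract_ract _ _ _ (by simp) (by simp)]
      simp only [M.V.inv_comp]
      exact M.ract_id' _
    calc _ = M.diag.comp (M.inclH (M.hPart (M.doubleLact a c hac)))
          (M.diag.comp (M.inclV (M.diagV a)) (M.inclH (M.diagH a)) (by simp))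
          (by simp [doubleLact]) := by
            congr 1
            exact M.diag_eq _
      _ = M.diag.comp (M.diag.comp (M.inclV (M.diagV (M.doubleRact a c hac)))
          (M.inclH (M.doubleOmega a c hac)) (by simp [doubleRact, hO]))
          (M.inclH (M.diagH a)) (by simp) := by
            rw [← M.diag.assoc _ _ _ (by simp [doubleLact])]
            refine M.diag.comp_congr ?_ rfl _ _
            refine (M.inclH_comp_inclV (by simp [doubleLact])).trans ?_
            exact M.diag.comp_congr rfl (congrArg M.inclH hO) _ _
      _ = M.diag.comp (M.inclV (M.diagV (M.doubleRact a c hac)))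
          (M.diag.comp (M.inclH (M.ract (M.diagH a) (M.vPart c) hac)) (M.inclH (M.hPart c))
            (by simp)) (by simp [doubleRact, hO]) := by
            rw [M.diag.assoc _ _ _ _ (by simp)]
            congr 1
            exact (M.inclH_comp (by simp)).symm.trans
              ((congrArg M.inclH hx).trans (M.inclH_comp (by simp)))
      _ = _ := by
            rw [← M.diag.assoc _ _ _ (by simp [doubleRact, hO])]
            congr 1
            exact (M.diag_eq (M.doubleRact a c hac)).symm

theorem DoubleCell.hcomp {a a' b b' : M.diag.Arr} {c c' c'' : M.doubleV.Arr}
    (h₁ : M.DoubleCell a a' c' c'') (h₂ : M.DoubleCell b b' c c')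
    (hab : M.diag.tgt a = M.diag.src b) (hab' : M.diag.tgt a' = M.diag.src b') :
    M.DoubleCell (M.diag.comp a b hab) (M.diag.comp a' b' hab') c c'' where
  right := (M.diag.tgt_comp _ _ _).trans h₂.right
  left := (M.diag.src_comp _ _ _).trans h₁.left
  right' := (M.diag.tgt_comp _ _ _).trans h₂.right'
  left' := (M.diag.src_comp _ _ _).trans h₁.left'
  sqV := M.diag.paste _ _ _ _ hab hab' h₁.sqV h₂.sqV
  sqH := M.diag.paste _ _ _ _ hab' hab h₁.sqH h₂.sqH

theorem DoubleCell.vcomp {a a' a'' : M.diag.Arr} {c c' d d' : M.doubleV.Arr}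
    (h₁ : M.DoubleCell a a' c c') (h₂ : M.DoubleCell a' a'' d d')
    (hcd : M.doubleV.tgt c = M.doubleV.src d) (hcd' : M.doubleV.tgt c' = M.doubleV.src d') :
    M.DoubleCell a a'' (M.doubleV.comp c d hcd) (M.doubleV.comp c' d' hcd') where
  right := h₁.right.trans (M.doubleV.src_comp _ _ _).symm
  left := h₁.left.trans (M.doubleV.src_comp _ _ _).symm
  right' := h₂.right'.trans (M.doubleV.tgt_comp _ _ _).symm
  left' := h₂.left'.trans (M.doubleV.tgt_comp _ _ _).symm
  sqV := by
    have e := M.diag.paste _ _ _ _ ((M.tgt_inclV _).trans (hcd'.trans (M.src_inclV _).symm))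
      ((M.tgt_inclV _).trans (hcd.trans (M.src_inclV _).symm)) h₁.sqV.symm h₂.sqV.symm
    refine (M.diag.comp_congr ?_ rfl _ _).trans (e.symm.trans (M.diag.comp_congr rfl ?_ _ _))
    · exact M.inclV_comp hcd'
    · exact (M.inclV_comp hcd).symm
  sqH := by
    have e := M.diag.paste _ _ _ _
      ((M.tgt_inclH _).trans (((M.tgt_hPart _).trans hcd'.symm).trans
        ((M.src_inclH _).trans (M.src_hPart _)).symm))
      ((M.tgt_inclH _).trans (((M.tgt_hPart _).trans hcd.symm).trans
        ((M.src_inclH _).trans (M.src_hPart _)).symm)) h₂.sqH.symm h₁.sqH.symm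
    refine (M.diag.comp_congr ?_ rfl _ _).trans (e.symm.trans (M.diag.comp_congr rfl ?_ _ _))
    · exact M.inclH_comp ((M.tgt_hPart _).trans (hcd'.symm.trans (M.src_hPart _).symm))
    · exact (M.inclH_comp ((M.tgt_hPart _).trans (hcd.symm.trans (M.src_hPart _).symm))).symm

theorem DoubleCell.idH (c : M.doubleV.Arr) :
    M.DoubleCell (M.diag.id (M.doubleV.src c)) (M.diag.id (M.doubleV.tgt c)) c c where
  right := M.diag.tgt_id _
  left := M.diag.src_id _
  right' := M.diag.tgt_id _
  left' := M.diag.src_id _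
  sqV := (M.diag.comp_id' _).trans (M.diag.id_comp' _).symm
  sqH := (M.diag.comp_id' _).trans (M.diag.id_comp' _).symm

theorem DoubleCell.idV (a : M.diag.Arr) :
    M.DoubleCell a a (M.doubleV.id (M.diag.tgt a)) (M.doubleV.id (M.diag.src a)) where
  right := (M.doubleV.src_id _).symm
  left := (M.doubleV.src_id _).symm
  right' := (M.doubleV.tgt_id _).symm
  left' := (M.doubleV.tgt_id _).symm
  sqV := by
    refine (M.diag.comp_congr (M.inclV_id _) rfl _ (by simp)).trans ?_
    refine (M.diag.id_comp' _).trans ?_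
    exact ((M.diag.comp_congr rfl (M.inclV_id _) _ (by simp)).trans (M.diag.comp_id' _)).symm
  sqH := by
    refine (M.diag.comp_congr (M.inclH_id _) rfl _ (by simp)).trans ?_
    refine (M.diag.id_comp' _).trans ?_
    exact ((M.diag.comp_congr rfl (M.inclH_id _) _ (by simp)).trans (M.diag.comp_id' _)).symm

variable (M)

/-- The double `D(V, H) = (V ⊡ H^op, V ⋈ H)` of a matched pair `(V, H)`. -/
def double : MatchedPair P where
  V := M.doubleV
  H := M.diag
  lact := M.doubleLact
  ract := M.doubleRact
  src_lact := M.src_doubleLact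
  tgt_ract := M.tgt_doubleRact
  tgt_lact := M.tgt_doubleLact
  lact_lact a b c h₁ h₂ :=
    ((doubleCell a _ (h₁.trans (M.src_doubleLact b c h₂).symm)).hcomp (doubleCell b c h₂) h₁
      ((M.tgt_doubleRact _ _ _).trans (M.tgt_doubleLact b c h₂))).unique (doubleCell _ c _) |>.1
  id_lact c := ((doubleCell _ c _).unique (DoubleCell.idH c)).1
  ract_ract a c d h₁ h₂ :=
    ((doubleCell a c h₁).vcomp (doubleCell _ d ((M.tgt_doubleRact a c h₁).trans h₂)) h₂
      ((M.tgt_doubleLact a c h₁).trans (M.src_doubleLact _ _ _).symm)).unique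
        (doubleCell a _ _) |>.2
  ract_id a := ((doubleCell a _ _).unique (DoubleCell.idV a)).2
  lact_comp a c d h₁ h₂ :=
    ((doubleCell a _ _).unique ((doubleCell a c h₁).vcomp
      (doubleCell _ d ((M.tgt_doubleRact a c h₁).trans h₂)) h₂
      ((M.tgt_doubleLact a c h₁).trans (M.src_doubleLact _ _ _).symm))).1
  comp_ract a b c h₁ h₂ :=
    ((doubleCell _ c _).unique ((doubleCell a _ (h₁.trans (M.src_doubleLact b c h₂).symm)).hcomp
      (doubleCell b c h₂) h₁ ((M.tgt_doubleRact _ _ _).trans (M.tgt_doubleLact b c h₂)))).2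

end MatchedPair

/-- A (set-theoretic) representation of a matched pair `(V, H)`: a quiver `p, q : E → P` with a
left action of `H` on `p` and a grading over `V` (given by the degree map `e ↦ |e|`), such that
`p(e) = t(|e|)`, `q(e) = b(|e|)` and `|x ▷ e| = x ▷ |e|`. -/
structure MatchedRep {P : Type u} (M : MatchedPair P) where
  carrier : Type u
  p : carrier → P
  q : carrier → P
  act : (x : M.H.Arr) → (e : carrier) → M.H.tgt x = p e → carrier
  deg : carrier → M.V.Arr
  p_act : ∀ x e h, p (act x e h) = M.H.src x
  act_act : ∀ x y e (h₁ : M.H.tgt x = M.H.src y) (h₂ : M.H.tgt y = p e),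
    act x (act y e h₂) (h₁.trans (p_act y e h₂).symm) =
      act (M.H.comp x y h₁) e ((M.H.tgt_comp x y h₁).trans h₂)
  id_act : ∀ e, act (M.H.id (p e)) e (M.H.tgt_id _) = e
  p_eq : ∀ e, p e = M.V.src (deg e)
  q_eq : ∀ e, q e = M.V.tgt (deg e)
  deg_act : ∀ x e h, deg (act x e h) = M.lact x (deg e) (h.trans (p_eq e))

namespace MatchedRep

variable {P : Type u} {M : MatchedPair P}

/-- A morphism of representations: a map which intertwines the actions and preserves degrees. -/
@[ext]
structure Hom (E F : MatchedRep M) where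
  toFun : E.carrier → F.carrier
  map_p : ∀ e, F.p (toFun e) = E.p e
  map_act : ∀ x e (h : M.H.tgt x = E.p e),
    toFun (E.act x e h) = F.act x (toFun e) (h.trans (map_p e).symm)
  map_deg : ∀ e, F.deg (toFun e) = E.deg e

theorem Hom.map_q {E F : MatchedRep M} (f : Hom E F) (e : E.carrier) : F.q (f.toFun e) = E.q e := by
  rw [F.q_eq, E.q_eq, f.map_deg]

theorem q_act (E : MatchedRep M) (x : M.H.Arr) (e : E.carrier) (h : M.H.tgt x = E.p e) :
    E.q (E.act x e h) = M.H.src (M.ract x (E.deg e) (h.trans (E.p_eq e))) := by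
  rw [E.q_eq, E.deg_act, M.tgt_lact]

theorem id_act' (E : MatchedRep M) {X : P} {e : E.carrier} (h : M.H.tgt (M.H.id X) = E.p e) :
    E.act (M.H.id X) e h = e := by
  obtain rfl : X = E.p e := by simpa using h
  exact E.id_act e

theorem act_congr (E : MatchedRep M) {x x' : M.H.Arr} {e e' : E.carrier} (hx : x = x') (he : e = e')
    (h : M.H.tgt x = E.p e) (h' : M.H.tgt x' = E.p e') : E.act x e h = E.act x' e' h' := by
  subst hx he
  rfl

instance : Category (MatchedRep M) where
  Hom := Hom
  id E := ⟨fun e => e, fun _ => rfl, fun _ _ _ => rfl, fun _ => rfl⟩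
  comp {E F K} f g := ⟨fun e => g.toFun (f.toFun e), fun e => (g.map_p _).trans (f.map_p e),
    fun x e h => by simp only [f.map_act x e h, g.map_act],
    fun e => (g.map_deg _).trans (f.map_deg e)⟩

/-- The tensor product: the set of pairs `(e, f)` with `q(e) = p(f)`, with
`x ▷ (e, f) = (x ▷ e, (x ◁ |e|) ▷ f)` and `|(e, f)| = |e| |f|`. -/
def tensor (E F : MatchedRep M) : MatchedRep M where
  carrier := {a : E.carrier × F.carrier // E.q a.1 = F.p a.2}
  p a := E.p a.1.1
  q a := F.q a.1.2
  act x a h := ⟨(E.act x a.1.1 h, F.act (M.ract x (E.deg a.1.1) (h.trans (E.p_eq _))) a.1.2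
      ((M.tgt_ract _ _ _).trans ((E.q_eq _).symm.trans a.2))),
    (E.q_act _ _ _).trans (F.p_act _ _ _).symm⟩
  deg a := M.V.comp (E.deg a.1.1) (F.deg a.1.2)
    ((E.q_eq _).symm.trans (a.2.trans (F.p_eq _)))
  p_act x a h := E.p_act x a.1.1 h
  act_act x y a h₁ h₂ := by
    refine Subtype.ext (Prod.ext (E.act_act _ _ _ _ _) ?_)
    refine (F.act_act _ _ _ ?_ _).trans (F.act_congr ?_ rfl _ _)
    · simp [E.deg_act]
    · simp only [E.deg_act]
      exact (M.comp_ract _ _ _ _ _).symm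
  id_act a := by
    refine Subtype.ext (Prod.ext (E.id_act _) ?_)
    refine (F.act_congr (M.id_ract _) rfl _ ?_).trans (F.id_act' _)
    exact (M.H.tgt_id _).trans ((E.q_eq _).symm.trans a.2)
  p_eq a := (E.p_eq _).trans (M.V.src_comp _ _ _).symm
  q_eq a := (F.q_eq _).trans (M.V.tgt_comp _ _ _).symm
  deg_act x a h := by
    simp only [E.deg_act, F.deg_act]
    exact (M.lact_comp _ _ _ _ _).symm

/-- The unit representation: the set `P`, with `|X| = id X` and `x ▷ r(x) = l(x)`. -/
def unit (M : MatchedPair P) : MatchedRep M where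
  carrier := P
  p X := X
  q X := X
  act x _ _ := M.H.src x
  deg X := M.V.id X
  p_act _ _ _ := rfl
  act_act x y X h₁ h₂ := (M.H.src_comp _ _ _).symm
  id_act X := M.H.src_id X
  p_eq X := (M.V.src_id X).symm
  q_eq X := (M.V.tgt_id X).symm
  deg_act x X h := (M.lact_id _).symm

/-- The tensor product of two morphisms. -/
def tensorMap {E E' F F' : MatchedRep M} (f : E ⟶ E') (g : F ⟶ F') : tensor E F ⟶ tensor E' F' where
  toFun a := ⟨(f.toFun a.1.1, g.toFun a.1.2),
    (f.map_q _).trans (a.2.trans (g.map_p _).symm)⟩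
  map_p a := f.map_p _
  map_act x a h := by
    refine Subtype.ext (Prod.ext (f.map_act _ _ _) ?_)
    refine (g.map_act _ _ _).trans (F'.act_congr ?_ rfl _ _)
    simp only [f.map_deg]
  map_deg a := M.V.comp_congr (f.map_deg _) (g.map_deg _) _ _

/-- The associativity constraint `((e, f), k) ↦ (e, (f, k))`. -/
def assocIso (E F K : MatchedRep M) : tensor (tensor E F) K ≅ tensor E (tensor F K) where
  hom :=
    { toFun := fun a => ⟨(a.1.1.1.1, ⟨(a.1.1.1.2, a.1.2), a.2⟩), a.1.1.2⟩
      map_p := fun _ => rfl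
      map_act := fun x a h => Subtype.ext (Prod.ext rfl (Subtype.ext (Prod.ext rfl
        (K.act_congr (M.ract_ract _ _ _ _ _).symm rfl _ _))))
      map_deg := fun a => (M.V.assoc _ _ _ _ _).symm }
  inv :=
    { toFun := fun a => ⟨(⟨(a.1.1, a.1.2.1.1), a.2⟩, a.1.2.1.2), a.1.2.2⟩
      map_p := fun _ => rfl
      map_act := fun x a h => Subtype.ext (Prod.ext rfl
        (K.act_congr (M.ract_ract _ _ _ _ _) rfl _ _))
      map_deg := fun a => M.V.assoc _ _ _ _ _ }

/-- The left unit constraint `(X, e) ↦ e`. -/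
def leftUnitIso (E : MatchedRep M) : tensor (unit M) E ≅ E where
  hom :=
    { toFun := fun a => a.1.2
      map_p := fun a => a.2.symm
      map_act := fun x a h => E.act_congr (M.ract_id' _) rfl _ _
      map_deg := fun a => (M.V.id_comp' _).symm }
  inv :=
    { toFun := fun e => ⟨(E.p e, e), rfl⟩
      map_p := fun _ => rfl
      map_act := fun x e h => Subtype.ext (Prod.ext (E.p_act _ _ _)
        (E.act_congr (M.ract_id' _).symm rfl _ _))
      map_deg := fun e => M.V.id_comp' _ }
  hom_inv_id := Hom.ext (funext fun a => Subtype.ext (Prod.ext a.2.symm rfl))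

/-- The right unit constraint `(e, X) ↦ e`. -/
def rightUnitIso (E : MatchedRep M) : tensor E (unit M) ≅ E where
  hom :=
    { toFun := fun a => a.1.1
      map_p := fun _ => rfl
      map_act := fun _ _ _ => rfl
      map_deg := fun a => (M.V.comp_id' _).symm }
  inv :=
    { toFun := fun e => ⟨(e, E.q e), rfl⟩
      map_p := fun _ => rfl
      map_act := fun x e h => Subtype.ext (Prod.ext rfl (E.q_act _ _ _))
      map_deg := fun e => M.V.comp_id' _ }
  hom_inv_id := Hom.ext (funext fun a => Subtype.ext (Prod.ext rfl a.2))

instance : MonoidalCategoryStruct (MatchedRep M) where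
  tensorObj := tensor
  whiskerLeft E _ _ f := tensorMap (𝟙 E) f
  whiskerRight f E := tensorMap f (𝟙 E)
  tensorHom f g := tensorMap f g
  tensorUnit := unit M
  associator := assocIso
  leftUnitor := leftUnitIso
  rightUnitor := rightUnitIso

instance : MonoidalCategory (MatchedRep M) := MonoidalCategory.ofTensorHom

open MonoidalCategory

/-- The element `(e, f)` of `E ⊗ F`. -/
def pair {E F : MatchedRep M} (e : E.carrier) (f : F.carrier) (h : E.q e = F.p f) :
    (E ⊗ F).carrier := ⟨(e, f), h⟩

/-- The underlying pair of an element of `E ⊗ F`. -/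
def coords {E F : MatchedRep M} (a : (E ⊗ F).carrier) : E.carrier × F.carrier := Subtype.val a

/-- The component in `V` of the degree of an element of a representation of the double. -/
def degV {E : MatchedRep M.double} (e : E.carrier) : M.V.Arr := M.vPart (E.deg e)

/-- The component in `H` of the degree of an element of a representation of the double. -/
def degH {E : MatchedRep M.double} (e : E.carrier) : M.H.Arr := M.hPart (E.deg e)

/-- The action of `V` on a representation of the double, by restriction along `V → V ⋈ H`. -/
def actV {E : MatchedRep M.double} (g : M.V.Arr) (e : E.carrier) (h : M.V.tgt g = E.p e) : E.carrier :=
  E.act (M.inclV g) e ((M.tgt_inclV g).trans h)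

/-- The action of `H` on a representation of the double, by restriction along `H → V ⋈ H`. -/
def actH {E : MatchedRep M.double} (x : M.H.Arr) (e : E.carrier) (h : M.H.tgt x = E.p e) : E.carrier :=
  E.act (M.inclH x) e ((M.tgt_inclH x).trans h)

theorem src_degV {E : MatchedRep M.double} (e : E.carrier) : M.V.src (degV e) = E.p e := (E.p_eq e).symm

theorem tgt_degV {E : MatchedRep M.double} (e : E.carrier) : M.V.tgt (degV e) = E.q e := (E.q_eq e).symm

theorem tgt_degH {E : MatchedRep M.double} (e : E.carrier) : M.H.tgt (degH e) = E.p e :=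
  (M.tgt_hPart _).trans (src_degV e)

theorem src_degH {E : MatchedRep M.double} (e : E.carrier) : M.H.src (degH e) = E.q e :=
  (M.src_hPart _).trans (tgt_degV e)

/-- For `q(e) = p(d)`, the horizontal arrow `|d|_H ◁ |e|_V⁻¹`. -/
def twist {E D : MatchedRep M.double} (e : E.carrier) (d : D.carrier) (h : E.q e = D.p d) : M.H.Arr :=
  M.ract (degH d) (M.V.inv (degV e))
    ((tgt_degH d).trans (h.symm.trans ((tgt_degV e).symm.trans (M.V.src_inv _).symm)))

theorem tgt_twist {E D : MatchedRep M.double} (e : E.carrier) (d : D.carrier) (h : E.q e = D.p d) :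
    M.H.tgt (twist e d h) = E.p e :=
  (M.tgt_ract _ _ _).trans ((M.V.tgt_inv _).trans (src_degV e))

end MatchedRep

/-!
The braiding is best understood inside the diagonal groupoid `V ⋈ H`. An element `e` of a
representation of the double has two arrows attached to it: `υ(e) = (|e|_V, id)`, from `p(e)` to
`q(e)`, and `κ(e) = (id, |e|_H)`, from `q(e)` to `p(e)`. The two squares of `DoubleCell` say that
`υ(a ▷ e) (a ↼ |e|) = a υ(e)` and `κ(a ▷ e) a = (a ↼ |e|) κ(e)` for every arrow `a`.

The formula for the braiding becomes `c(e, d) = (d', e')` with `d' = υ(e) ▷ d` and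
`e' = κ(d') ▷ e`, because the twisted arrow `|d|_H ◁ |e|_V⁻¹` is the horizontal degree of `d'`
(`degH_crossFst`). The squares of `υ(e)` with `d` and of `κ(d')` with `e` share the arrow
`κ(d') υ(e)`, and each factors it as a vertical arrow followed by a horizontal one. Such
factorizations are unique, so `υ(e) ↼ |d| = υ(e')` and `κ(d') ↼ |e| = κ(d)` (`ract_ups`,
`ract_kap`). With these two identities, preservation of degrees is what remains of the two squares,
and both hexagons are the definition of the action on a tensor product; equivariance is the pair of
squares of an arbitrary arrow `a`. The braiding is invertible because `(d', e')` determines first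
`e = κ(d')⁻¹ ▷ e'` and then `d = υ(e)⁻¹ ▷ d'`.
-/

/-! ### Factorizations in the diagonal groupoid -/

namespace MatchedPair

variable {P : Type u} {M : MatchedPair P}

/-- Uniqueness of the factorization of a diagonal arrow as a vertical arrow followed by a
horizontal one. -/
theorem inclV_inclH_unique {g : M.V.Arr} {x : M.H.Arr} {a b : M.diag.Arr} {X Y : P}
    (ha : M.diagV a = M.V.id X) (hb : M.diagH b = M.H.id Y)
    (h₁ : M.diag.tgt (M.inclV g) = M.diag.src a) (h₂ : M.diag.tgt b = M.diag.src (M.inclH x))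
    (e : M.diag.comp (M.inclV g) a h₁ = M.diag.comp b (M.inclH x) h₂) :
    b = M.inclV g ∧ a = M.inclH x := by
  have hX : X = M.H.src (M.diagH a) := by
    rw [src_diagH, ha, M.V.tgt_id]
  have hY : Y = M.V.tgt (M.diagV b) := by
    rw [← src_diagH, hb, M.H.src_id]
  have ea : a = M.inclH (M.diagH a) := M.diag_ext (by rw [ha, diagV_inclH, hX]) rfl
  have eb : b = M.inclV (M.diagV b) := M.diag_ext rfl (by rw [hb, diagH_inclV, hY])
  generalize M.diagH a = y at ea
  generalize M.diagV b = f at eb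
  subst ea eb
  rw [M.inclV_comp_inclH (by simpa using h₁), M.inclV_comp_inclH (by simpa using h₂)] at e
  have e₁ := congrArg M.diagV e
  have e₂ := congrArg M.diagH e
  simp only [diagV_corner, diagH_corner] at e₁ e₂
  rw [e₁, e₂]
  exact ⟨rfl, rfl⟩

theorem doubleV_ext {c c' : M.doubleV.Arr}
    (h₁ : M.inclV (M.vPart c) = M.inclV (M.vPart c'))
    (h₂ : M.inclH (M.hPart c) = M.inclH (M.hPart c')) : c = c' :=
  Subtype.ext (Prod.ext (congrArg M.diagV h₁) (congrArg M.diagH h₂))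

/-- For a vertical arrow `g`, the horizontal component of `(g, id) ⇀ (γ, x)` is `x ◁ g⁻¹`. -/
theorem hPart_doubleLact_inclV (g : M.V.Arr) (c : M.doubleV.Arr)
    (h : M.H.tgt (M.diagH (M.inclV g)) = M.V.src (M.vPart c)) :
    M.hPart (M.doubleLact (M.inclV g) c h) =
      M.ract (M.hPart c) (M.V.inv g)
        ((M.tgt_hPart c).trans (h.symm.trans ((M.H.tgt_id _).trans (M.V.src_inv g).symm))) := by
  -- For `a = (g, id)` the arrow `Ω` is `x` itself.
  have hΩ : M.doubleOmega (M.inclV g) c h = M.hPart c := by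
    have h' : M.V.tgt g = M.V.src (M.vPart c) := by simpa using h
    refine M.H.right_cancel (g := M.diagH (M.inclV g)) (by simp)
      (by simp [h']) ?_
    simp only [doubleOmega]
    rw [M.H.assoc _ _ _ _ (by simp)]
    simp only [M.H.inv_comp, diagH_inclV, M.H.comp_id', M.id_ract, M.H.id_comp']
  simp only [doubleLact, hPart_mk, hΩ, diagV_inclV]

end MatchedPair

namespace MatchedRep

variable {P : Type u} {M : MatchedPair P}

/-! ### Isomorphisms of representations -/

/-- Arrows act injectively. -/
theorem act_injective (E : MatchedRep M) {x : M.H.Arr} {e e' : E.carrier}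
    (h : M.H.tgt x = E.p e) (h' : M.H.tgt x = E.p e') (he : E.act x e h = E.act x e' h') :
    e = e' := by
  have key : ∀ (z : E.carrier) (hz : M.H.tgt x = E.p z),
      E.act (M.H.inv x) (E.act x z hz) (by rw [E.p_act, M.H.tgt_inv]) = z := by
    intro z hz
    rw [E.act_act _ _ _ (M.H.tgt_inv x) hz]
    exact (E.act_congr (M.H.inv_comp x) rfl _ (by simpa using hz)).trans (E.id_act' _)
  rw [← key e h, ← key e' h']
  simp only [he]

theorem act_act_inv (E : MatchedRep M) {x : M.H.Arr} {e : E.carrier} (h : M.H.src x = E.p e) :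
    E.act x (E.act (M.H.inv x) e ((M.H.tgt_inv x).trans h))
      (by rw [E.p_act, M.H.src_inv]) = e := by
  rw [E.act_act _ _ _ (M.H.src_inv x).symm ((M.H.tgt_inv x).trans h)]
  exact (E.act_congr (M.H.comp_inv x) rfl _ (by simpa using h)).trans (E.id_act' _)

/-- A bijective morphism of representations is an isomorphism. -/
noncomputable def isoOfBijective {E F : MatchedRep M} (f : E ⟶ F)
    (hf : Function.Bijective f.toFun) : E ≅ F where
  hom := f
  inv :=
    have hr : ∀ a, f.toFun ((Equiv.ofBijective _ hf).symm a) = a :=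
      (Equiv.ofBijective _ hf).apply_symm_apply
    { toFun := (Equiv.ofBijective _ hf).symm
      map_p := fun a => by rw [← f.map_p, hr]
      map_act := fun x a h => hf.1 (by
        rw [hr, f.map_act _ _ (by rw [← f.map_p, hr]; exact h)]
        exact F.act_congr rfl (hr a).symm _ _)
      map_deg := fun a => by rw [← f.map_deg, hr] }
  hom_inv_id := Hom.ext (funext (Equiv.ofBijective _ hf).symm_apply_apply)
  inv_hom_id := Hom.ext (funext (Equiv.ofBijective _ hf).apply_symm_apply)

/-! ### The diagonal arrows attached to an element of a representation of the double -/

variable {E D F : MatchedRep M.double}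

/-- The arrow `υ(e) = (|e|_V, id)` of `V ⋈ H`, from `p(e)` to `q(e)`. -/
def ups (e : E.carrier) : M.double.H.Arr := M.inclV (degV e)

/-- The arrow `κ(e) = (id, |e|_H)` of `V ⋈ H`, from `q(e)` to `p(e)`. -/
def kap (e : E.carrier) : M.double.H.Arr := M.inclH (degH e)

theorem src_ups (e : E.carrier) : M.double.H.src (ups e) = E.p e :=
  (M.src_inclV _).trans (src_degV e)

theorem tgt_ups (e : E.carrier) : M.double.H.tgt (ups e) = E.q e :=
  (M.tgt_inclV _).trans (tgt_degV e)

theorem src_kap (e : E.carrier) : M.double.H.src (kap e) = E.q e :=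
  (M.src_inclH _).trans (src_degH e)

theorem tgt_kap (e : E.carrier) : M.double.H.tgt (kap e) = E.p e :=
  (M.tgt_inclH _).trans (tgt_degH e)

/-- The squares relating the degrees of `e` and of `a ▷ e`. -/
theorem cell_act (a : M.double.H.Arr) (e : E.carrier) (h : M.double.H.tgt a = E.p e) :
    M.DoubleCell a (M.double.ract a (E.deg e) (h.trans (E.p_eq e))) (E.deg e)
      (E.deg (E.act a e h)) := by
  rw [E.deg_act]
  exact MatchedPair.doubleCell a (E.deg e) (h.trans (E.p_eq e))

/-- `υ(a ▷ e) (a ↼ |e|) = a υ(e)`. -/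
theorem ups_act_comp (a : M.double.H.Arr) (e : E.carrier) (h : M.double.H.tgt a = E.p e)
    (h₁) (h₂) :
    M.double.H.comp (ups (E.act a e h)) (M.double.ract a (E.deg e) (h.trans (E.p_eq e))) h₁ =
      M.double.H.comp a (ups e) h₂ :=
  (cell_act a e h).sqV

/-- `κ(a ▷ e) a = (a ↼ |e|) κ(e)`. -/
theorem kap_act_comp (a : M.double.H.Arr) (e : E.carrier) (h : M.double.H.tgt a = E.p e)
    (h₁) (h₂) :
    M.double.H.comp (kap (E.act a e h)) a h₁ =
      M.double.H.comp (M.double.ract a (E.deg e) (h.trans (E.p_eq e))) (kap e) h₂ :=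
  (cell_act a e h).sqH

/-! ### The crossing map -/

/-- The first component `d' = υ(e) ▷ d` of the braiding. -/
def crossFst (e : E.carrier) (d : D.carrier) (h : E.q e = D.p d) : D.carrier :=
  D.act (ups e) d ((tgt_ups e).trans h)

theorem p_crossFst (e : E.carrier) (d : D.carrier) (h : E.q e = D.p d) :
    D.p (crossFst e d h) = E.p e :=
  (D.p_act _ _ _).trans (src_ups e)

/-- The second component of the braiding, `e' = κ(d') ▷ e` with `d' = crossFst e d h`. -/
def crossSnd (e : E.carrier) (d : D.carrier) (h : E.q e = D.p d) : E.carrier :=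
  E.act (kap (crossFst e d h)) e ((tgt_kap _).trans (p_crossFst e d h))

theorem q_crossFst (e : E.carrier) (d : D.carrier) (h : E.q e = D.p d) :
    D.q (crossFst e d h) = E.p (crossSnd e d h) :=
  (src_kap _).symm.trans (E.p_act _ _ _).symm

/-- The arrow `|d|_H ◁ |e|_V⁻¹` is the horizontal degree of `d'`. -/
theorem degH_crossFst (e : E.carrier) (d : D.carrier) (h : E.q e = D.p d) :
    degH (crossFst e d h) = twist e d h := by
  unfold degH crossFst
  rw [D.deg_act]
  exact MatchedPair.hPart_doubleLact_inclV _ _ _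

/-- The square of `υ(e)` with `d` and that of `κ(d')` with `e` give two factorizations of
`κ(d') υ(e)` as a vertical arrow followed by a horizontal one; comparing them identifies both
right actions. -/
theorem ract_ups_and_kap (e : E.carrier) (d : D.carrier) (h : E.q e = D.p d) (h₁) (h₂) :
    M.double.ract (ups e) (D.deg d) h₁ = ups (crossSnd e d h) ∧
      M.double.ract (kap (crossFst e d h)) (E.deg e) h₂ = kap d := by
  have I := cell_act (ups e) d ((tgt_ups e).trans h)
  have J := cell_act (kap (crossFst e d h)) e ((tgt_kap _).trans (p_crossFst e d h))
  exact MatchedPair.inclV_inclH_unique (M.lact_id _) (M.id_ract _) _ _ (J.sqV.trans I.sqH)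

theorem ract_ups (e : E.carrier) (d : D.carrier) (h : E.q e = D.p d) (h₁) :
    M.double.ract (ups e) (D.deg d) h₁ = ups (crossSnd e d h) :=
  (ract_ups_and_kap e d h h₁
    ((tgt_kap _).trans ((p_crossFst e d h).trans (E.p_eq e)))).1

theorem ract_kap (e : E.carrier) (d : D.carrier) (h : E.q e = D.p d) (h₂) :
    M.double.ract (kap (crossFst e d h)) (E.deg e) h₂ = kap d :=
  (ract_ups_and_kap e d h ((tgt_ups e).trans (h.trans (D.p_eq d))) h₂).2

/-- Preservation of degrees, `|d'| |e'| = |e| |d|`: the two components of this equality are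
`υ(d') υ(e') = υ(e) υ(d)` and `κ(e') κ(d') = κ(d) κ(e)`. -/
theorem deg_cross (e : E.carrier) (d : D.carrier) (h : E.q e = D.p d) (h₁) (h₂) :
    M.double.V.comp (D.deg (crossFst e d h)) (E.deg (crossSnd e d h)) h₁ =
      M.double.V.comp (E.deg e) (D.deg d) h₂ := by
  have h₃ : M.double.H.tgt (ups (crossFst e d h)) = M.double.H.src (ups (crossSnd e d h)) := by
    rw [tgt_ups, src_ups, q_crossFst]
  have h₄ : M.double.H.tgt (ups e) = M.double.H.src (ups d) := by rw [tgt_ups, src_ups, h]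
  have h₅ : M.double.H.tgt (kap (crossSnd e d h)) = M.double.H.src (kap (crossFst e d h)) := by
    rw [tgt_kap, src_kap, q_crossFst]
  have h₆ : M.double.H.tgt (kap d) = M.double.H.src (kap e) := by rw [tgt_kap, src_kap, h]
  have sqV : M.double.H.comp (ups (crossFst e d h)) (ups (crossSnd e d h)) h₃ =
      M.double.H.comp (ups e) (ups d) h₄ := by
    have e₁ := ract_ups e d h ((tgt_ups e).trans (h.trans (D.p_eq d)))
    exact (M.double.H.comp_congr rfl e₁.symm _ (by rw [e₁]; exact h₃)).trans
      (ups_act_comp (ups e) d ((tgt_ups e).trans h) _ _)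
  have sqH : M.double.H.comp (kap (crossSnd e d h)) (kap (crossFst e d h)) h₅ =
      M.double.H.comp (kap d) (kap e) h₆ := by
    have e₂ := ract_kap e d h ((tgt_kap _).trans ((p_crossFst e d h).trans (E.p_eq e)))
    exact (kap_act_comp (kap (crossFst e d h)) e _ h₅ (by rw [e₂]; exact h₆)).trans
      (M.double.H.comp_congr e₂ rfl _ _)
  exact M.doubleV_ext
    ((M.inclV_comp _).trans (sqV.trans (M.inclV_comp _).symm))
    ((M.inclH_comp _).trans (sqH.trans (M.inclH_comp _).symm))

theorem q_crossSnd (e : E.carrier) (d : D.carrier) (h : E.q e = D.p d) :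
    E.q (crossSnd e d h) = D.q d := by
  have e₁ := congrArg M.double.V.tgt (deg_cross e d h
    ((D.q_eq _).symm.trans ((q_crossFst e d h).trans (E.p_eq _)))
    ((E.q_eq _).symm.trans (h.trans (D.p_eq _))))
  rwa [M.double.V.tgt_comp, M.double.V.tgt_comp, ← E.q_eq, ← D.q_eq] at e₁

/-- Equivariance of the first component: `υ(a ▷ e) ▷ ((a ↼ |e|) ▷ d) = a ▷ (υ(e) ▷ d)`. -/
theorem crossFst_act (a : M.double.H.Arr) (e : E.carrier) (d : D.carrier) (h : E.q e = D.p d)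
    (ha : M.double.H.tgt a = E.p e) (hb) (hc) :
    crossFst (E.act a e ha) (D.act (M.double.ract a (E.deg e) (ha.trans (E.p_eq e))) d hb) hc =
      D.act a (crossFst e d h) (ha.trans (p_crossFst e d h).symm) := by
  have h₁ : M.double.H.tgt a = M.double.H.src (ups e) := ha.trans (src_ups e).symm
  have h₂ : M.double.H.tgt (ups (E.act a e ha)) =
      M.double.H.src (M.double.ract a (E.deg e) (ha.trans (E.p_eq e))) :=
    (tgt_ups _).trans (hc.trans (D.p_act _ _ _))
  refine (D.act_act _ _ _ h₂ hb).trans ((D.act_congr (ups_act_comp a e ha h₂ h₁) rfl _ ?_).trans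
    (D.act_act a (ups e) d h₁ ((tgt_ups e).trans h)).symm)
  exact (M.double.H.tgt_comp _ _ _).trans ((tgt_ups e).trans h)

/-- Equivariance of the second component: `κ(a ▷ d') ▷ (a ▷ e) = (a ↼ |d'|) ▷ (κ(d') ▷ e)`. -/
theorem crossSnd_act (a : M.double.H.Arr) (e : E.carrier) (d : D.carrier) (h : E.q e = D.p d)
    (ha : M.double.H.tgt a = E.p e) (hb) (hc) (hd) :
    crossSnd (E.act a e ha) (D.act (M.double.ract a (E.deg e) (ha.trans (E.p_eq e))) d hb) hc =
      E.act (M.double.ract a (D.deg (crossFst e d h))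
        (ha.trans ((p_crossFst e d h).symm.trans (D.p_eq _)))) (crossSnd e d h) hd := by
  have h₀ : M.double.H.tgt a = D.p (crossFst e d h) := ha.trans (p_crossFst e d h).symm
  have h₁ : M.double.H.tgt (kap (D.act a (crossFst e d h) h₀)) = M.double.H.src a :=
    (tgt_kap _).trans (D.p_act _ _ _)
  have h₂ : M.double.H.tgt (M.double.ract a (D.deg (crossFst e d h)) (h₀.trans (D.p_eq _))) =
      M.double.H.src (kap (crossFst e d h)) := hd.trans (E.p_act _ _ _)
  have h₃ : M.double.H.tgt (kap (crossFst e d h)) = E.p e :=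
    (tgt_kap _).trans (p_crossFst e d h)
  refine (E.act_congr (congrArg kap (crossFst_act a e d h ha hb hc)) rfl _
    (h₁.trans (E.p_act _ _ _).symm)).trans ?_
  refine (E.act_act _ _ _ h₁ ha).trans
    ((E.act_congr (kap_act_comp a (crossFst e d h) h₀ h₁ h₂) rfl _ ?_).trans
      (E.act_act _ _ _ h₂ h₃).symm)
  exact (M.double.H.tgt_comp _ _ _).trans h₃

/-! ### The braiding -/

/-- The braiding `(e, d) ↦ (d', e')`, as a morphism of representations. -/
def crossHom (E D : MatchedRep M.double) : tensor E D ⟶ tensor D E where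
  toFun a := ⟨(crossFst a.1.1 a.1.2 a.2, crossSnd a.1.1 a.1.2 a.2), q_crossFst _ _ _⟩
  map_p a := p_crossFst _ _ a.2
  map_act x a h := Subtype.ext (Prod.ext
    (crossFst_act x a.1.1 a.1.2 a.2 h _ ((tensor E D).act x a h).2)
    (crossSnd_act x a.1.1 a.1.2 a.2 h _ ((tensor E D).act x a h).2
      ((M.double.tgt_ract _ _ _).trans ((D.q_eq _).symm.trans (q_crossFst _ _ a.2)))))
  map_deg _ := deg_cross _ _ _ _ _

theorem crossHom_bijective (E D : MatchedRep M.double) :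
    Function.Bijective (crossHom E D).toFun := by
  constructor
  · rintro ⟨⟨e₁, d₁⟩, h₁⟩ ⟨⟨e₂, d₂⟩, h₂⟩ he
    have hd : crossFst e₁ d₁ h₁ = crossFst e₂ d₂ h₂ := congrArg (fun z => (Subtype.val z).1) he
    have he : crossSnd e₁ d₁ h₁ = crossSnd e₂ d₂ h₂ := congrArg (fun z => (Subtype.val z).2) he
    have h₃ : e₁ = e₂ := by
      refine E.act_injective ((tgt_kap _).trans (p_crossFst e₁ d₁ h₁)) ?_
        (he.trans (E.act_congr (congrArg kap hd.symm) rfl _ ?_))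
      all_goals rw [hd]; exact (tgt_kap _).trans (p_crossFst e₂ d₂ h₂)
    subst h₃
    have h₄ : d₁ = d₂ := D.act_injective _ _ hd
    subst h₄
    rfl
  · rintro ⟨⟨d', e'⟩, h⟩
    have h₁ : M.double.H.src (kap d') = E.p e' := (src_kap d').trans h
    obtain ⟨e, he⟩ : ∃ e, e = E.act (M.double.H.inv (kap d')) e'
      ((M.double.H.tgt_inv _).trans h₁) := ⟨_, rfl⟩
    have h₂ : M.double.H.src (ups e) = D.p d' := by
      rw [src_ups, he, E.p_act, M.double.H.src_inv, tgt_kap]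
    obtain ⟨d, hd⟩ : ∃ d, d = D.act (M.double.H.inv (ups e)) d'
      ((M.double.H.tgt_inv _).trans h₂) := ⟨_, rfl⟩
    have hq : E.q e = D.p d := by rw [hd, D.p_act, M.double.H.src_inv, tgt_ups]
    have e₁ : crossFst e d hq = d' := by
      subst hd
      exact D.act_act_inv h₂
    refine ⟨⟨(e, d), hq⟩, Subtype.ext (Prod.ext e₁ ?_)⟩
    refine (E.act_congr (congrArg kap e₁) he _ ?_).trans (E.act_act_inv h₁)
    rw [E.p_act, M.double.H.src_inv]

theorem crossHom_naturality {E E' D D' : MatchedRep M.double} (f : E ⟶ E') (g : D ⟶ D')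
    (a : (tensor E D).carrier) :
    (crossHom E' D').toFun ((tensorMap f g).toFun a) =
      (tensorMap g f).toFun ((crossHom E D).toFun a) := by
  obtain ⟨⟨e, d⟩, h⟩ := a
  have h' : E'.q (f.toFun e) = D'.p (g.toFun d) :=
    (f.map_q e).trans (h.trans (g.map_p d).symm)
  have hf : ups (f.toFun e) = ups e := congrArg (fun c => M.inclV (M.vPart c)) (f.map_deg e)
  have hg : kap (g.toFun (crossFst e d h)) = kap (crossFst e d h) :=
    congrArg (fun c => M.inclH (M.hPart c)) (g.map_deg _)
  have e₁ : crossFst (f.toFun e) (g.toFun d) h' = g.toFun (crossFst e d h) :=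
    (D'.act_congr hf rfl _ (by rw [tgt_ups, h, g.map_p])).trans (g.map_act _ _ _).symm
  refine Subtype.ext (Prod.ext e₁ ?_)
  refine (E'.act_congr ((congrArg kap e₁).trans hg) rfl _ ?_).trans (f.map_act _ _ _).symm
  exact (tgt_kap _).trans ((p_crossFst e d h).trans (f.map_p e).symm)

theorem crossFst_tensor_left (e : E.carrier) (d : D.carrier) (f : F.carrier)
    (h : E.q e = D.p d) (h' : D.q d = F.p f) (h₁) (h₂) :
    crossFst (E := tensor E D) ⟨(e, d), h⟩ f h₁ = crossFst e (crossFst d f h') h₂ := by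
  have h₃ : M.double.H.tgt (ups e) = M.double.H.src (ups d) := by rw [tgt_ups, src_ups, h]
  have e₁ : ups (E := tensor E D) ⟨(e, d), h⟩ = M.double.H.comp (ups e) (ups d) h₃ :=
    M.inclV_comp _
  refine (F.act_congr e₁ rfl _ ?_).trans (F.act_act _ _ _ h₃ ((tgt_ups d).trans h')).symm
  exact (M.double.H.tgt_comp _ _ _).trans ((tgt_ups d).trans h')

theorem crossSnd_tensor_left (e : E.carrier) (d : D.carrier) (f : F.carrier)
    (h : E.q e = D.p d) (h' : D.q d = F.p f) (h₁) (h₂) (h₃) :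
    crossSnd (E := tensor E D) ⟨(e, d), h⟩ f h₁ =
      ⟨(crossSnd e (crossFst d f h') h₂, crossSnd d f h'), h₃⟩ := by
  have e₁ := congrArg kap (crossFst_tensor_left e d f h h' h₁ h₂)
  have h₄ : M.double.H.tgt (kap (crossFst e (crossFst d f h') h₂)) = E.p e :=
    (tgt_kap _).trans (p_crossFst _ _ _)
  refine ((tensor E D).act_congr (e' := ⟨(e, d), h⟩) e₁ rfl _ h₄).trans
    (Subtype.ext (Prod.ext rfl ?_))
  exact D.act_congr (ract_kap e (crossFst d f h') h₂ (h₄.trans (E.p_eq e))) rfl _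
    ((tgt_kap _).trans (p_crossFst d f h'))

theorem crossFst_tensor_right (e : E.carrier) (d : D.carrier) (f : F.carrier)
    (h : E.q e = D.p d) (h' : D.q d = F.p f) (h₁) (h₂) (h₃) :
    crossFst (D := tensor D F) e ⟨(d, f), h'⟩ h₁ =
      ⟨(crossFst e d h, crossFst (crossSnd e d h) f h₂), h₃⟩ :=
  Subtype.ext (Prod.ext rfl
    (F.act_congr (ract_ups e d h ((tgt_ups e).trans (h.trans (D.p_eq d)))) rfl _
      ((tgt_ups _).trans h₂)))

theorem crossSnd_tensor_right (e : E.carrier) (d : D.carrier) (f : F.carrier)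
    (h : E.q e = D.p d) (h' : D.q d = F.p f) (h₁) (h₂) :
    crossSnd (D := tensor D F) e ⟨(d, f), h'⟩ h₁ = crossSnd (crossSnd e d h) f h₂ := by
  have h₄ : M.double.H.tgt (kap (crossFst (crossSnd e d h) f h₂)) =
      M.double.H.src (kap (crossFst e d h)) := by
    rw [tgt_kap, src_kap, p_crossFst, q_crossFst]
  have e₁ : kap (crossFst (D := tensor D F) e ⟨(d, f), h'⟩ h₁) =
      M.double.H.comp (kap (crossFst (crossSnd e d h) f h₂)) (kap (crossFst e d h)) h₄ :=
    (congrArg kap (crossFst_tensor_right e d f h h' h₁ h₂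
      ((q_crossFst e d h).trans (p_crossFst _ f h₂).symm))).trans (M.inclH_comp _)
  have h₅ : M.double.H.tgt (kap (crossFst e d h)) = E.p e :=
    (tgt_kap _).trans (p_crossFst e d h)
  refine (E.act_congr e₁ rfl _ ?_).trans (E.act_act _ _ _ h₄ h₅).symm
  exact (M.double.H.tgt_comp _ _ _).trans h₅

end MatchedRep

theorem corollary3 {P : Type u} (M : MatchedPair P) :
    ∃ B : BraidedCategory (MatchedRep M.double),
      ∀ (E D : MatchedRep M.double) (e : E.carrier) (d : D.carrier) (h : E.q e = D.p d),
        MatchedRep.coords ((B.braiding E D).hom.toFun (MatchedRep.pair e d h)) =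
          (MatchedRep.actV (MatchedRep.degV e) d ((MatchedRep.tgt_degV e).trans h),
            MatchedRep.actH (MatchedRep.twist e d h) e (MatchedRep.tgt_twist e d h)) := by
  refine ⟨{
    braiding := fun E D => MatchedRep.isoOfBijective _ (MatchedRep.crossHom_bijective E D)
    braiding_naturality_right := fun X _ _ f => MatchedRep.Hom.ext (funext fun a =>
      MatchedRep.crossHom_naturality (𝟙 X) f a)
    braiding_naturality_left := fun f Z => MatchedRep.Hom.ext (funext fun a =>
      MatchedRep.crossHom_naturality f (𝟙 Z) a)
    hexagon_forward := fun X Y Z => MatchedRep.Hom.ext (funext fun a => ?_)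
    hexagon_reverse := fun X Y Z => MatchedRep.Hom.ext (funext fun a => ?_) }, ?_⟩
  · obtain ⟨⟨⟨⟨e, d⟩, h⟩, f⟩, h'⟩ := a
    have h₂ : X.q (MatchedRep.crossSnd e d h) = Z.p f := by
      rw [MatchedRep.q_crossSnd]; exact h'
    have h₃ := (MatchedRep.q_crossFst e d h).trans (MatchedRep.p_crossFst _ f h₂).symm
    refine Subtype.ext (Prod.ext ?_ (Subtype.ext (Prod.ext ?_ ?_)))
    · rfl
    · exact congrArg (fun z => (Subtype.val z).2)
        (MatchedRep.crossFst_tensor_right e d f h h' h h₂ h₃)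
    · exact MatchedRep.crossSnd_tensor_right e d f h h' h h₂
  · obtain ⟨⟨e, ⟨⟨d, f⟩, h'⟩⟩, h⟩ := a
    have h₂ : X.q e = Z.p (MatchedRep.crossFst d f h') :=
      h.trans (MatchedRep.p_crossFst d f h').symm
    have h₃ : X.q (MatchedRep.crossSnd e _ h₂) = Y.p (MatchedRep.crossSnd d f h') :=
      (MatchedRep.q_crossSnd _ _ _).trans (MatchedRep.q_crossFst d f h')
    have e₂ := MatchedRep.crossSnd_tensor_left e d f h h' h' h₂ h₃
    refine Subtype.ext (Prod.ext (Subtype.ext (Prod.ext ?_ ?_)) ?_)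
    · exact MatchedRep.crossFst_tensor_left e d f h h' h' h₂
    · exact congrArg (fun z => (Subtype.val z).1) e₂
    · exact congrArg (fun z => (Subtype.val z).2) e₂
  · intro E D e d h
    refine Prod.ext rfl ?_
    exact E.act_congr (congrArg M.inclH (MatchedRep.degH_crossFst e d h)) rfl _ _
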